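/- Let $I=[0,1]$ and $I_{k,l}=[l2^{-k},(l+1)2^{-k}]$ with characteristic function $\chi_{k,l}$. For $0<A\le 1$ let $\Phi_{2,A}(u)=u^2$ for $0\le u\le 1$ and $\Phi_{2,A}(u)=\exp\bigl((u^2-1)/A\bigr)$ for $u>1$, and for measurable $g$ on $I$ let $$\|g\|_{2,A}=\inf\Bigl\{\lambda>0:\int_0^1\Phi_{2,A}\bigl(|g(t)|/\lambda\bigr)\,dt\le 1\Bigr\}\in[0,\infty]$$ be the associated Orlicz norm. For $f\in C(I)$ (real- or complex-valued) and $h>0$ put $\Delta_h^2f(x)=f(x+2h)-2f(x+h)+f(x)$ if $x,x+h,x+2h\in I$, and $\Delta^2_hf(x)=0$ otherwise. For integers $0\le k\le j$ and $x\in I$ let $$D^2_{j,k}f(x)=\sum_{l=0}^{2^k-1}\chi_{k,l}(x)\,2^k\int_{l2^{-k}}^{(l+1)2^{-k}}|\Delta^2_{2^{-j-1}}f(t)|\,dt,\qquad \mathfrak D^2_{j,k}f(x)=2^k\int_{x-2^{-k-1}}^{x+2^{-k-1}}|\Delta^2_{2^{-j-1}}f(t)|\,dt,$$ and $$\|f\|_D=\sup_{j\ge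 0}\,\sup_{0\le k\le j}\bigl\|2^{j/2}D^2_{j,k}f\bigr\|_{2,2^{k-j}},\qquad \|f\|_{\mathfrak D}=\sup_{j\ge 0}\,\sup_{0\le k\le j}\bigl\|2^{j/2}\mathfrak D^2_{j,k}f\bigr\|_{2,2^{k-j}},$$ both with values in $[0,\infty]$. **Theorem.** (i) There is an absolute constant $C>0$ such that for every $f\in C(I)$ $$\|f\|_D\le C\,\|f\|_{\mathfrak D}\qquad\text{and}\qquad \|f\|_{\mathfrak D}\le C\,\|f\|_D .$$ Let $W=(W_t)_{t\ge 0}$ be a real-valued Wiener process (Brownian motion) with almost surely continuous paths, and consider the restrictions of its paths to $I$. (ii) $\|W_\cdot\|_D<\infty$ almost surely. (iii) $\|W_\cdot\|_{\mathfrak D}<\infty$ almost surely. -/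

import Mathlib

namespace DyadicAverages

open MeasureTheory

/-- The Young function `Φ_{2,A}` on `[0, ∞)`: `u ^ 2` for `u ≤ 1` and `exp ((u ^ 2 - 1) / A)` for
`u > 1`. -/
noncomputable def youngFun (A u : ℝ) : ℝ :=
  if u ≤ 1 then u ^ 2 else Real.exp ((u ^ 2 - 1) / A)

/-- The (Luxemburg) Orlicz norm `‖g‖_{2,A}` on `I = [0,1]` associated with `Φ_{2,A}`, with values in
`[0, ∞]` (the infimum of the empty set is `∞`). -/
noncomputable def orliczNorm (A : ℝ) (g : ℝ → ℝ) : ENNReal :=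
  ⨅ (r : ℝ) (_ : 0 < r ∧
    ∫⁻ x in Set.Icc (0 : ℝ) 1, ENNReal.ofReal (youngFun A (|g x| / r)) ≤ 1), ENNReal.ofReal r

variable {E : Type*} [NormedAddCommGroup E]

/-- Second order difference of `f` with step `h`, restricted to `I = [0,1]`: it is zero unless
`x`, `x + h` and `x + 2 h` all lie in `I`. Only the values of `f` on `I` matter. -/
noncomputable def secondDiff (h : ℝ) (f : ℝ → E) (x : ℝ) : E :=
  if x ∈ Set.Icc (0 : ℝ) 1 ∧ x + h ∈ Set.Icc (0 : ℝ) 1 ∧ x + 2 * h ∈ Set.Icc (0 : ℝ) 1 then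
    f (x + 2 * h) - (2 : ℕ) • f (x + h) + f x
  else 0

/-- The dyadic interval `I_{k,l} = [l 2^{-k}, (l+1) 2^{-k}]`. -/
def dyadicInterval (k l : ℕ) : Set ℝ :=
  Set.Icc ((l : ℝ) / 2 ^ k) (((l : ℝ) + 1) / 2 ^ k)

/-- `D²_{j,k} f`: the averages of `|Δ²_{2^{-j-1}} f|` over the dyadic intervals of length
`2^{-k}`. -/
noncomputable def dyadicAvg (j k : ℕ) (f : ℝ → E) (x : ℝ) : ℝ :=
  ∑ l ∈ Finset.range (2 ^ k), (dyadicInterval k l).indicator (fun _ => (1 : ℝ)) x *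
    (2 ^ k * ∫ t in ((l : ℝ) / 2 ^ k)..(((l : ℝ) + 1) / 2 ^ k), ‖secondDiff (1 / 2 ^ (j + 1)) f t‖)

/-- `𝔇²_{j,k} f`: the averages of `|Δ²_{2^{-j-1}} f|` over the centered windows
`(x - 2^{-k-1}, x + 2^{-k-1})`. -/
noncomputable def centeredAvg (j k : ℕ) (f : ℝ → E) (x : ℝ) : ℝ :=
  2 ^ k * ∫ t in (x - 1 / 2 ^ (k + 1))..(x + 1 / 2 ^ (k + 1)), ‖secondDiff (1 / 2 ^ (j + 1)) f t‖

/-- `‖f‖_D`, the supremum over `0 ≤ k ≤ j` of `‖2^{j/2} D²_{j,k} f‖_{2,2^{k-j}}`. -/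
noncomputable def normD (f : ℝ → E) : ENNReal :=
  ⨆ (j : ℕ) (k : ℕ) (_ : k ≤ j),
    orliczNorm ((2 : ℝ) ^ ((k : ℤ) - (j : ℤ)))
      (fun x => (2 : ℝ) ^ ((j : ℝ) / 2) * dyadicAvg j k f x)

/-- `‖f‖_𝔇`, the supremum over `0 ≤ k ≤ j` of `‖2^{j/2} 𝔇²_{j,k} f‖_{2,2^{k-j}}`. -/
noncomputable def normFrakD (f : ℝ → E) : ENNReal :=
  ⨆ (j : ℕ) (k : ℕ) (_ : k ≤ j),
    orliczNorm ((2 : ℝ) ^ ((k : ℤ) - (j : ℤ)))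
      (fun x => (2 : ℝ) ^ ((j : ℝ) / 2) * centeredAvg j k f x)

end DyadicAverages

/-! Equivalence of the two norms is a covering argument. A half of a dyadic cell of length `2^{-k}`
lies in the centered window of each of its points. Conversely, the window of a point lies in its
cell together with the two neighbours, and cells outside `[0,1]` contribute nothing. This compares
modulars up to factors 2 and 3, at scales changed by the same factors. The inequality
`youngFun_div_le` turns a factor `K` on the modular into a factor `√K` on the norm, and the
constants do not depend on `A ≤ 1`.

For Brownian motion put `j = k + n` and `N = 2^n`, so that `A = 1/N`. For a fixed offset `u`, the
scaled second differences started at `(m + u)/2^j` are independent standard Gaussians: they are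
jointly Gaussian and uncorrelated. The scaled average over a cell is at most the mean over `u ∈
[0,1]` of averages of `N` such absolute values (`scaled_average_le`). Jensen in `u` and
Cauchy–Schwarz in `m` bound the exponential `exp(N y²/8)` of this average `y` by the mean over `u`
of `exp(1/8 · sum of N squares)` (`exp_sq_average_le`).

At scale `√8` the modular is therefore at most `1 + e^{-N}` times the mean over `u` of an empirical
mean over `2^k` independent blocks. A block exponential has expectation `(4/3)^{N/2}`, which
`e^{-N}` absorbs. Expectations alone would not be summable in `k`, so the mean is subtracted first:
the variance of the empirical mean is at most `2^{N/2} 2^{-k}`, and the normalized squared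
deviations have expectations at most `2^{-k} 2^{-n}`. Their sum over all `k, n` is almost surely
finite, which bounds all the modulars at once. -/

namespace DyadicAverages

open MeasureTheory

/-! ### The Young function and comparison of Orlicz norms through modulars -/

section Young

variable {A : ℝ}

lemma youngFun_of_le {u : ℝ} (hu : u ≤ 1) : youngFun A u = u ^ 2 := if_pos hu

lemma youngFun_of_lt {u : ℝ} (hu : 1 < u) : youngFun A u = Real.exp ((u ^ 2 - 1) / A) :=
  if_neg hu.not_ge

lemma youngFun_nonneg (A u : ℝ) : 0 ≤ youngFun A u := by
  unfold youngFun; split_ifs <;> positivity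

lemma youngFun_mono (hA : 0 < A) {u v : ℝ} (hu : 0 ≤ u) (huv : u ≤ v) :
    youngFun A u ≤ youngFun A v := by
  have hsq : u ^ 2 ≤ v ^ 2 := by gcongr
  rcases le_or_gt v 1 with hv | hv
  · rw [youngFun_of_le hv, youngFun_of_le (huv.trans hv)]
    exact hsq
  rcases le_or_gt u 1 with hu1 | hu1
  · rw [youngFun_of_le hu1, youngFun_of_lt hv]
    have h1 : u ^ 2 ≤ 1 := pow_le_one₀ hu hu1
    refine h1.trans (Real.one_le_exp (div_nonneg ?_ hA.le))
    nlinarith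
  · rw [youngFun_of_lt hu1, youngFun_of_lt hv]
    gcongr

/-- Growth is at least quadratic: `x ≤ exp (x - 1)` together with `A ≤ 1` lets the exponential pay
for the factor `c ^ 2`. This takes the place of convexity of the Young function throughout. -/
lemma youngFun_div_le (hA : 0 < A) (hA1 : A ≤ 1) {u c : ℝ} (hu : 0 ≤ u) (hc : 1 ≤ c) :
    youngFun A (u / c) ≤ youngFun A u / c ^ 2 := by
  have hc0 : 0 < c := by linarith
  rcases le_or_gt u 1 with hu1 | hu1
  · rw [youngFun_of_le hu1, youngFun_of_le ((div_le_one hc0).2 (hu1.trans hc)), div_pow]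
  rw [youngFun_of_lt hu1]
  rcases le_or_gt (u / c) 1 with h1 | h1
  · rw [youngFun_of_le h1, div_pow]
    gcongr
    have h2 : u ^ 2 - 1 ≤ (u ^ 2 - 1) / A := le_div_self (by nlinarith) hA hA1
    linarith [Real.add_one_le_exp (u ^ 2 - 1), Real.exp_le_exp.2 h2]
  · rw [youngFun_of_lt h1, le_div_iff₀ (by positivity)]
    have hcu : c < u := (one_lt_div hc0).1 h1
    have h3 : c ^ 2 ≤ Real.exp (c ^ 2 - 1) := by linarith [Real.add_one_le_exp (c ^ 2 - 1)]
    refine (mul_le_mul_of_nonneg_left h3 (Real.exp_pos _).le).trans ?_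
    rw [← Real.exp_add]
    apply Real.exp_le_exp.2
    have h4 : c ^ 2 - 1 ≤ (c ^ 2 - 1) / A := le_div_self (by nlinarith) hA hA1
    -- With `w = u / c`, this is `(w² - 1)(c² - 1) ≥ 0`.
    have h5 : ((u / c) ^ 2 - 1) + (c ^ 2 - 1) ≤ u ^ 2 - 1 := by
      have h6 : u = (u / c) * c := by field_simp
      set w := u / c
      rw [h6]
      nlinarith [mul_nonneg (show 0 ≤ w ^ 2 - 1 by nlinarith) (show 0 ≤ c ^ 2 - 1 by nlinarith)]
    calc ((u / c) ^ 2 - 1) / A + (c ^ 2 - 1)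
        ≤ ((u / c) ^ 2 - 1) / A + (c ^ 2 - 1) / A := by gcongr
      _ = (((u / c) ^ 2 - 1) + (c ^ 2 - 1)) / A := by ring
      _ ≤ _ := by gcongr

/-- The mean is at most the maximum, so monotonicity suffices. -/
lemma youngFun_half_add_le (hA : 0 < A) {u v : ℝ} (hu : 0 ≤ u) (hv : 0 ≤ v) :
    youngFun A ((u + v) / 2) ≤ youngFun A u + youngFun A v := by
  rcases le_total u v with h | h
  · linarith [youngFun_mono hA (u := (u + v) / 2) (v := v) (by positivity) (by linarith),
      youngFun_nonneg A u]
  · linarith [youngFun_mono hA (u := (u + v) / 2) (v := u) (by positivity) (by linarith),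
      youngFun_nonneg A v]

lemma youngFun_third_add_le (hA : 0 < A) {u v w : ℝ} (hu : 0 ≤ u) (hv : 0 ≤ v) (hw : 0 ≤ w) :
    youngFun A ((u + v + w) / 3) ≤ youngFun A u + youngFun A v + youngFun A w := by
  have key : ∀ m, u ≤ m → v ≤ m → w ≤ m → youngFun A ((u + v + w) / 3) ≤ youngFun A m :=
    fun m h1 h2 h3 ↦ youngFun_mono hA (by positivity) (by linarith)
  have := youngFun_nonneg A u
  have := youngFun_nonneg A v
  have := youngFun_nonneg A w
  rcases le_total u v with h | h <;> rcases le_total v w with h' | h' <;>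
    rcases le_total u w with h'' | h''
  all_goals first
    | linarith [key w (by linarith) (by linarith) le_rfl]
    | linarith [key v (by linarith) le_rfl (by linarith)]
    | linarith [key u le_rfl (by linarith) (by linarith)]

lemma youngFun_le_one_add_exp {u : ℝ} (hu : 0 ≤ u) :
    youngFun A u ≤ 1 + Real.exp ((u ^ 2 - 1) / A) := by
  rcases le_or_gt u 1 with h | h
  · rw [youngFun_of_le h]
    have : u ^ 2 ≤ 1 := pow_le_one₀ hu h
    linarith [Real.exp_pos ((u ^ 2 - 1) / A)]
  · rw [youngFun_of_lt h]
    linarith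

/-- The modular of `g / r` on `[0,1]`. -/
noncomputable def modular (A r : ℝ) (g : ℝ → ℝ) : ENNReal :=
  ∫⁻ x in Set.Icc (0 : ℝ) 1, ENNReal.ofReal (youngFun A (|g x| / r))

lemma orliczNorm_le {g : ℝ → ℝ} {r : ℝ} (hr : 0 < r) (h : modular A r g ≤ 1) :
    orliczNorm A g ≤ ENNReal.ofReal r :=
  iInf₂_le r ⟨hr, h⟩

/-- A bound `K ≥ 1` on the modular costs a factor `√K` in the norm. -/
lemma orliczNorm_le_of_modular_le (hA : 0 < A) (hA1 : A ≤ 1) {g : ℝ → ℝ} {r K : ℝ} (hr : 0 < r)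
    (hK : 1 ≤ K) (h : modular A r g ≤ ENNReal.ofReal K) :
    orliczNorm A g ≤ ENNReal.ofReal (√K * r) := by
  have hK0 : 0 < K := by linarith
  refine orliczNorm_le (by positivity) ?_
  calc modular A (√K * r) g
      ≤ ∫⁻ x in Set.Icc (0 : ℝ) 1,
          ENNReal.ofReal K⁻¹ * ENNReal.ofReal (youngFun A (|g x| / r)) := by
        refine lintegral_mono fun x ↦ ?_
        rw [← ENNReal.ofReal_mul (by positivity)]
        apply ENNReal.ofReal_le_ofReal
        have := youngFun_div_le hA hA1 (u := |g x| / r) (c := √K) (by positivity)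
          (by rwa [Real.one_le_sqrt])
        rw [Real.sq_sqrt hK0.le, div_div, mul_comm r] at this
        rwa [inv_mul_eq_div]
    _ = ENNReal.ofReal K⁻¹ * modular A r g := lintegral_const_mul' _ _ ENNReal.ofReal_ne_top
    _ ≤ ENNReal.ofReal K⁻¹ * ENNReal.ofReal K := by gcongr
    _ = 1 := by
        rw [← ENNReal.ofReal_mul (by positivity), inv_mul_cancel₀ hK0.ne', ENNReal.ofReal_one]

/-- A modular inequality valid at every scale passes to the infimum over admissible scales; an
infinite norm of `g` needs no separate treatment. -/
lemma orliczNorm_le_mul (hA : 0 < A) (hA1 : A ≤ 1) {g g' : ℝ → ℝ} {c K : ℝ} (hc : 0 < c)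
    (hK : 1 ≤ K) (h : ∀ r, 0 < r → modular A (c * r) g' ≤ ENNReal.ofReal K * modular A r g) :
    orliczNorm A g' ≤ ENNReal.ofReal (√K * c) * orliczNorm A g := by
  have hK0 : 0 < K := by linarith
  unfold orliczNorm
  rw [ENNReal.mul_iInf_of_ne (ENNReal.ofReal_pos.2 (by positivity)).ne' ENNReal.ofReal_ne_top]
  refine le_iInf fun r ↦ ?_
  rw [ENNReal.mul_iInf_of_ne (ENNReal.ofReal_pos.2 (by positivity)).ne' ENNReal.ofReal_ne_top]
  refine le_iInf fun hr ↦ ?_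
  rw [← ENNReal.ofReal_mul (by positivity), mul_assoc]
  refine orliczNorm_le_of_modular_le hA hA1 (mul_pos hc hr.1) hK ((h r hr.1).trans ?_)
  exact mul_le_of_le_one_right' hr.2

end Young

/-! ### Decomposition of the modular over dyadic cells -/

section Cells

/-- Open cells are used because the closed dyadic intervals share endpoints, where the dyadic
average counts two cells; these points form a null set. -/
lemma lintegral_unit_eq_sum (k : ℕ) (F : ℝ → ENNReal) :
    ∫⁻ x in Set.Icc (0 : ℝ) 1, F x =
      ∑ l ∈ Finset.range (2 ^ k),
        ∫⁻ x in Set.Ioo ((l : ℝ) / 2 ^ k) (((l : ℝ) + 1) / 2 ^ k), F x := by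
  have key : ∀ n : ℕ, ∫⁻ x in Set.Ioc (0 : ℝ) ((n : ℝ) / 2 ^ k), F x =
      ∑ l ∈ Finset.range n,
        ∫⁻ x in Set.Ioo ((l : ℝ) / 2 ^ k) (((l : ℝ) + 1) / 2 ^ k), F x := by
    intro n
    induction n with
    | zero => simp
    | succ n ih =>
      rw [Finset.sum_range_succ, ← ih, setLIntegral_congr Ioo_ae_eq_Ioc,
        ← lintegral_union measurableSet_Ioc (Set.Ioc_disjoint_Ioc_of_le le_rfl),
        Set.Ioc_union_Ioc_eq_Ioc (by positivity) (by gcongr; linarith)]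
      push_cast
      rfl
  have := key (2 ^ k)
  rw [← this]
  push_cast
  rw [div_self (by positivity)]
  exact setLIntegral_congr Ioc_ae_eq_Icc.symm

lemma dyadicAvg_eq {E : Type*} [NormedAddCommGroup E] (j k : ℕ) (f : ℝ → E) {l : ℕ}
    (hl : l < 2 ^ k) {x : ℝ} (hx : x ∈ Set.Ioo ((l : ℝ) / 2 ^ k) (((l : ℝ) + 1) / 2 ^ k)) :
    dyadicAvg j k f x = 2 ^ k * ∫ t in ((l : ℝ) / 2 ^ k)..(((l : ℝ) + 1) / 2 ^ k),
      ‖secondDiff (1 / 2 ^ (j + 1)) f t‖ := by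
  unfold dyadicAvg
  rw [Finset.sum_eq_single l]
  · rw [Set.indicator_of_mem (show x ∈ dyadicInterval k l from Set.Ioo_subset_Icc_self hx), one_mul]
  · intro m _ hml
    rw [Set.indicator_of_notMem, zero_mul]
    rintro ⟨h1, h2⟩
    have h3 : (m : ℝ) < l + 1 := by
      have := h1.trans_lt hx.2
      rwa [div_lt_div_iff_of_pos_right (by positivity)] at this
    have h4 : (l : ℝ) < m + 1 := by
      have := hx.1.trans_le h2
      rwa [div_lt_div_iff_of_pos_right (by positivity)] at this
    norm_cast at h3 h4
    omega
  · intro h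
    exact absurd (Finset.mem_range.2 hl) h

lemma modular_dyadicAvg {E : Type*} [NormedAddCommGroup E] (A r s : ℝ) (hs : 0 ≤ s) (j k : ℕ)
    (f : ℝ → E) :
    modular A r (fun x ↦ s * dyadicAvg j k f x) =
      ∑ l ∈ Finset.range (2 ^ k), ENNReal.ofReal (youngFun A (s * (2 ^ k *
        ∫ t in ((l : ℝ) / 2 ^ k)..(((l : ℝ) + 1) / 2 ^ k),
          ‖secondDiff (1 / 2 ^ (j + 1)) f t‖) / r)) * ENNReal.ofReal (1 / 2 ^ k) := by
  unfold modular
  rw [lintegral_unit_eq_sum k]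
  refine Finset.sum_congr rfl fun l hl ↦ ?_
  have h0 : 0 ≤ ∫ t in ((l : ℝ) / 2 ^ k)..(((l : ℝ) + 1) / 2 ^ k),
      ‖secondDiff (1 / 2 ^ (j + 1)) f t‖ :=
    intervalIntegral.integral_nonneg (by gcongr; linarith) fun _ _ ↦ norm_nonneg _
  rw [setLIntegral_congr_fun measurableSet_Ioo (g := fun _ ↦ ENNReal.ofReal (youngFun A (s * (2 ^ k *
        ∫ t in ((l : ℝ) / 2 ^ k)..(((l : ℝ) + 1) / 2 ^ k),
          ‖secondDiff (1 / 2 ^ (j + 1)) f t‖) / r))), setLIntegral_const, Real.volume_Ioo]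
  · congr 2
    ring
  · intro x hx
    simp only
    rw [dyadicAvg_eq j k f (Finset.mem_range.1 hl) hx, abs_of_nonneg (by positivity)]

end Cells

/-! ### Equivalence of the dyadic and centered norms -/

section Equivalence

variable {E : Type*} [NormedAddCommGroup E]

lemma secondDiff_eq_zero {h : ℝ} {f : ℝ → E} {x : ℝ} (hx : x ∉ Set.Icc (0 : ℝ) 1) :
    secondDiff h f x = 0 :=
  if_neg fun H ↦ hx H.1

lemma secondDiff_eq_indicator {h : ℝ} (hh : 0 ≤ h) (f : ℝ → E) :
    secondDiff h f = (Set.Icc (0 : ℝ) (1 - 2 * h)).indicator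
      fun x ↦ f (x + 2 * h) - (2 : ℕ) • f (x + h) + f x := by
  ext x
  unfold secondDiff
  by_cases hx : x ∈ Set.Icc (0 : ℝ) (1 - 2 * h)
  · rw [Set.indicator_of_mem hx, if_pos]
    obtain ⟨h1, h2⟩ := hx
    refine ⟨⟨?_, ?_⟩, ⟨?_, ?_⟩, ⟨?_, ?_⟩⟩ <;> linarith
  · rw [Set.indicator_of_notMem hx, if_neg]
    rintro ⟨⟨h1, -⟩, -, ⟨-, h2⟩⟩
    exact hx ⟨h1, by linarith⟩

lemma integrable_norm_secondDiff {h : ℝ} (hh : 0 ≤ h) {f : ℝ → E}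
    (hf : ContinuousOn f (Set.Icc 0 1)) :
    Integrable (fun t ↦ ‖secondDiff h f t‖) := by
  refine Integrable.norm ?_
  rw [secondDiff_eq_indicator hh, integrable_indicator_iff measurableSet_Icc]
  refine ContinuousOn.integrableOn_compact isCompact_Icc ?_
  have key : ∀ a, 0 ≤ a → a ≤ 2 * h →
      ContinuousOn (fun x ↦ f (x + a)) (Set.Icc (0 : ℝ) (1 - 2 * h)) := by
    intro a ha ha'
    refine hf.comp (by fun_prop) fun x hx ↦ ⟨?_, ?_⟩
    · linarith [hx.1]
    · linarith [hx.2]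
  have h0 := key 0 le_rfl (by linarith)
  simp only [add_zero] at h0
  exact ((key _ (by linarith) le_rfl).sub ((key h hh (by linarith)).const_smul (2 : ℕ))).add h0

lemma two_zpow_sub_pos (k j : ℕ) : (0 : ℝ) < 2 ^ ((k : ℤ) - (j : ℤ)) := by positivity

lemma two_zpow_sub_le_one {k j : ℕ} (h : k ≤ j) : (2 : ℝ) ^ ((k : ℤ) - (j : ℤ)) ≤ 1 :=
  zpow_le_one_of_nonpos₀ (by norm_num) (by omega)

lemma modular_dyadicAvg_le {A s r : ℝ} (hA : 0 < A) (hs : 0 ≤ s) (hr : 0 < r) (j k : ℕ)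
    {f : ℝ → E} (hf : ContinuousOn f (Set.Icc 0 1)) :
    modular A (2 * r) (fun x ↦ s * dyadicAvg j k f x) ≤
      ENNReal.ofReal 2 * modular A r (fun x ↦ s * centeredAvg j k f x) := by
  rw [modular_dyadicAvg A _ s hs, modular, lintegral_unit_eq_sum k, Finset.mul_sum]
  refine Finset.sum_le_sum fun l _ ↦ ?_
  have hgi := integrable_norm_secondDiff (h := 1 / 2 ^ (j + 1)) (by positivity) hf
  have hg0 : ∀ t, 0 ≤ ‖secondDiff (1 / 2 ^ (j + 1)) f t‖ := fun t ↦ norm_nonneg _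
  unfold centeredAvg
  set g : ℝ → ℝ := fun t ↦ ‖secondDiff (1 / 2 ^ (j + 1)) f t‖
  set a : ℝ := (l : ℝ) / 2 ^ k with ha
  set q : ℝ := 1 / 2 ^ (k + 1) with hq
  have hq0 : 0 < q := by positivity
  have hQ : (1 : ℝ) / 2 ^ k = 2 * q := by rw [hq, pow_succ]; field_simp
  have hb : ((l : ℝ) + 1) / 2 ^ k = a + 2 * q := by rw [ha, ← hQ]; ring
  rw [hb]
  have hmono : ∀ {u v c d : ℝ}, c ≤ u → u ≤ v → v ≤ d → ∫ t in u..v, g t ≤ ∫ t in c..d, g t :=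
    fun h1 h2 h3 ↦ intervalIntegral.integral_mono_interval h1 h2 h3
      (Filter.Eventually.of_forall hg0) hgi.intervalIntegrable
  have hnn : ∀ {u v : ℝ}, u ≤ v → 0 ≤ ∫ t in u..v, g t := fun h ↦
    intervalIntegral.integral_nonneg h fun _ _ ↦ hg0 _
  have hsplit : ∫ t in a..(a + 2 * q), g t =
      (∫ t in a..(a + q), g t) + ∫ t in (a + q)..(a + 2 * q), g t :=
    (intervalIntegral.integral_add_adjacent_intervals hgi.intervalIntegrable
      hgi.intervalIntegrable).symm
  set F : ℝ → ENNReal := fun x ↦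
    ENNReal.ofReal (youngFun A (|s * (2 ^ k * ∫ t in (x - q)..(x + q), g t)| / r))
  -- Here `q` is half the cell length: for `x` in `(c, c + q)` the window `(x - q, x + q)` contains
  -- the whole half-cell, so the centered average dominates pointwise.
  have hpart : ∀ c, ENNReal.ofReal (youngFun A (s * (2 ^ k * ∫ t in c..(c + q), g t) / r)) *
      ENNReal.ofReal q ≤ ∫⁻ x in Set.Ioo c (c + q), F x := by
    intro c
    have hv : ENNReal.ofReal q = volume (Set.Ioo c (c + q)) := by rw [Real.volume_Ioo]; ring_nf
    rw [hv, ← setLIntegral_const]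
    refine setLIntegral_mono' measurableSet_Ioo fun x hx ↦ ?_
    obtain ⟨hx1, hx2⟩ := hx
    have h1 := hmono (u := c) (v := c + q) (c := x - q) (d := x + q) (by linarith) (by linarith)
      (by linarith)
    have h2 := hnn (u := c) (v := c + q) (by linarith)
    refine ENNReal.ofReal_le_ofReal (youngFun_mono hA (by positivity) ?_)
    gcongr
    refine le_trans ?_ (le_abs_self _)
    gcongr
  have hunion : (∫⁻ x in Set.Ioo a (a + q), F x) + ∫⁻ x in Set.Ioo (a + q) (a + q + q), F x ≤
      ∫⁻ x in Set.Ioo a (a + 2 * q), F x := by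
    rw [← lintegral_union measurableSet_Ioo]
    · refine lintegral_mono_set (Set.union_subset ?_ ?_) <;> intro x hx <;>
        exact ⟨by linarith [hx.1], by linarith [hx.2]⟩
    · rw [Set.disjoint_left]
      exact fun x hx hx' ↦ by linarith [hx.2, hx'.1]
  refine le_trans ?_ (mul_le_mul_right (add_le_add (hpart a) (hpart (a + q)) |>.trans hunion) _)
  have e2 : a + 2 * q = a + q + q := by ring
  rw [e2] at hsplit ⊢
  have h1 := hnn (u := a) (v := a + q) (by linarith)
  have h2 := hnn (u := a + q) (v := a + q + q) (by linarith)
  -- The cell average at scale `2 * r` is the mean of the two half-cell quantities at scale `r`. The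
  -- factor 2 on the modular arises because each half-cell has only half the measure of the cell.
  have hmain := youngFun_half_add_le hA (u := s * (2 ^ k * ∫ t in a..(a + q), g t) / r)
    (v := s * (2 ^ k * ∫ t in (a + q)..(a + q + q), g t) / r) (by positivity) (by positivity)
  rw [← add_mul, ← ENNReal.ofReal_add (youngFun_nonneg _ _) (youngFun_nonneg _ _),
    ← ENNReal.ofReal_mul (add_nonneg (youngFun_nonneg _ _) (youngFun_nonneg _ _)),
    ← ENNReal.ofReal_mul (youngFun_nonneg _ _), ← ENNReal.ofReal_mul (by norm_num), hQ, hsplit]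
  refine ENNReal.ofReal_le_ofReal ?_
  refine (mul_le_mul_of_nonneg_right (le_trans (le_of_eq ?_) hmain)
    (by positivity : 0 ≤ 2 * q)).trans_eq (by ring)
  congr 1
  field_simp

lemma sum_range_pred_le {B : ℤ → ENNReal} (n : ℕ) (h0 : B (-1) = 0) :
    ∑ l ∈ Finset.range n, B ((l : ℤ) - 1) ≤ ∑ l ∈ Finset.range n, B l := by
  cases n with
  | zero => simp
  | succ n =>
    rw [Finset.sum_range_succ', Finset.sum_range_succ]
    simp [h0]

lemma sum_range_succ_le {B : ℤ → ENNReal} (n : ℕ) (h0 : B n = 0) :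
    ∑ l ∈ Finset.range n, B ((l : ℤ) + 1) ≤ ∑ l ∈ Finset.range n, B l := by
  cases n with
  | zero => simp
  | succ n =>
    rw [Finset.sum_range_succ, Finset.sum_range_succ' (fun l : ℕ ↦ B l)]
    push_cast at h0
    simp [h0]

lemma modular_centeredAvg_le {A s r : ℝ} (hA : 0 < A) (hs : 0 ≤ s) (hr : 0 < r) (j k : ℕ)
    {f : ℝ → E} (hf : ContinuousOn f (Set.Icc 0 1)) :
    modular A (3 * r) (fun x ↦ s * centeredAvg j k f x) ≤
      ENNReal.ofReal 3 * modular A r (fun x ↦ s * dyadicAvg j k f x) := by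
  rw [modular_dyadicAvg A _ s hs, modular, lintegral_unit_eq_sum k]
  have hgi := integrable_norm_secondDiff (h := 1 / 2 ^ (j + 1)) (by positivity) hf
  have hg0 : ∀ t, 0 ≤ ‖secondDiff (1 / 2 ^ (j + 1)) f t‖ := fun t ↦ norm_nonneg _
  have hgz : ∀ t, t ∉ Set.Icc (0 : ℝ) 1 → ‖secondDiff (1 / 2 ^ (j + 1)) f t‖ = 0 :=
    fun t ht ↦ by rw [secondDiff_eq_zero ht, norm_zero]
  unfold centeredAvg
  set g : ℝ → ℝ := fun t ↦ ‖secondDiff (1 / 2 ^ (j + 1)) f t‖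
  set q : ℝ := 1 / 2 ^ k with hq
  have hq0 : 0 < q := by positivity
  have hq2 : (1 : ℝ) / 2 ^ (k + 1) = q / 2 := by rw [hq, pow_succ]; field_simp
  have hmono : ∀ {u v c d : ℝ}, c ≤ u → u ≤ v → v ≤ d → ∫ t in u..v, g t ≤ ∫ t in c..d, g t :=
    fun h1 h2 h3 ↦ intervalIntegral.integral_mono_interval h1 h2 h3
      (Filter.Eventually.of_forall hg0) hgi.intervalIntegrable
  have hnn : ∀ {u v : ℝ}, u ≤ v → 0 ≤ ∫ t in u..v, g t := fun h ↦
    intervalIntegral.integral_nonneg h fun _ _ ↦ hg0 _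
  -- Integer indices supply the neighbours `-1` and `2 ^ k` of the extreme cells; there the
  -- integrals vanish since the second difference is zero outside `[0,1]`.
  set I : ℤ → ℝ := fun l ↦ ∫ t in ((l : ℝ) / 2 ^ k)..(((l : ℝ) + 1) / 2 ^ k), g t with hI
  have hI0 : ∀ l, 0 ≤ I l := fun l ↦ hnn (by gcongr; linarith)
  set B : ℤ → ENNReal := fun l ↦
    ENNReal.ofReal (youngFun A (s * (2 ^ k * I l) / r)) * ENNReal.ofReal q with hB
  have hBz : ∀ l, I l = 0 → B l = 0 := by
    intro l hl
    simp [hB, hl, youngFun]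
  have hIz : ∀ l : ℤ, (∀ t ∈ Set.Ioo ((l : ℝ) / 2 ^ k) (((l : ℝ) + 1) / 2 ^ k),
      t ∉ Set.Icc (0 : ℝ) 1) → I l = 0 := by
    intro l hl
    simp only [hI]
    rw [intervalIntegral.integral_of_le (by gcongr; linarith), integral_Ioc_eq_integral_Ioo]
    exact setIntegral_eq_zero_of_forall_eq_zero fun t ht ↦ hgz t (hl t ht)
  have hBm : B (-1) = 0 := by
    refine hBz _ (hIz _ fun t ht h ↦ ?_)
    have := ht.2
    push_cast at this
    rw [neg_add_cancel, zero_div] at this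
    linarith [h.1]
  have hBp : B ((2 ^ k : ℕ) : ℤ) = 0 := by
    refine hBz _ (hIz _ fun t ht h ↦ ?_)
    have := ht.1
    push_cast at this
    rw [div_self (by positivity)] at this
    linarith [h.2]
  have hrhs : ENNReal.ofReal 3 * ∑ l ∈ Finset.range (2 ^ k), B l ≥
      ∑ l ∈ Finset.range (2 ^ k), (B ((l : ℤ) - 1) + B l + B ((l : ℤ) + 1)) := by
    rw [Finset.sum_add_distrib, Finset.sum_add_distrib]
    have e3 : ENNReal.ofReal 3 = 1 + 1 + 1 := by norm_num
    rw [e3, add_mul, add_mul, one_mul]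
    exact add_le_add (add_le_add (sum_range_pred_le _ hBm) le_rfl) (sum_range_succ_le _ hBp)
  refine le_trans ?_ hrhs
  refine Finset.sum_le_sum fun l _ ↦ ?_
  have hv : ENNReal.ofReal q = volume (Set.Ioo ((l : ℝ) / 2 ^ k) (((l : ℝ) + 1) / 2 ^ k)) := by
    rw [Real.volume_Ioo, hq]; ring_nf
  simp only [hB]
  rw [← add_mul, ← add_mul, ← ENNReal.ofReal_add (youngFun_nonneg _ _) (youngFun_nonneg _ _),
    ← ENNReal.ofReal_add (add_nonneg (youngFun_nonneg _ _) (youngFun_nonneg _ _))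
      (youngFun_nonneg _ _), hv, ← setLIntegral_const]
  refine setLIntegral_mono' measurableSet_Ioo fun x hx ↦ ENNReal.ofReal_le_ofReal ?_
  have i1 := hI0 (l - 1)
  have i2 := hI0 l
  have i3 := hI0 (l + 1)
  refine le_trans (youngFun_mono hA (by positivity) ?_) (youngFun_third_add_le hA
    (by positivity) (by positivity) (by positivity))
  have hx1 := hx.1
  have hx2 := hx.2
  have e1 : ((l : ℝ) + 1) / 2 ^ k = l / 2 ^ k + q := by rw [hq]; ring
  -- The three adjacent cells form one interval, which contains the window of every point of the
  -- middle cell.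
  have hsum : I (l - 1) + I l + I (l + 1) =
      ∫ t in ((l : ℝ) / 2 ^ k - q)..((l : ℝ) / 2 ^ k + q + q), g t := by
    have hii : ∀ u v, IntervalIntegrable g volume u v := fun u v ↦ hgi.intervalIntegrable
    rw [← intervalIntegral.integral_add_adjacent_intervals (hii _ ((l : ℝ) / 2 ^ k + q)) (hii _ _),
      ← intervalIntegral.integral_add_adjacent_intervals (hii _ ((l : ℝ) / 2 ^ k))
        (hii _ ((l : ℝ) / 2 ^ k + q))]
    simp only [hI]
    push_cast
    congr <;> (try rw [hq]) <;> ring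
  have hle : ∫ t in (x - 1 / 2 ^ (k + 1))..(x + 1 / 2 ^ (k + 1)), g t ≤
      I (l - 1) + I l + I (l + 1) := by
    rw [hsum, hq2]
    rw [e1] at hx2
    exact hmono (by linarith) (by linarith) (by linarith)
  rw [abs_of_nonneg (mul_nonneg hs (mul_nonneg (by positivity) (hnn (by
    rw [hq2]; linarith))))]
  rw [div_le_iff₀ (by positivity)]
  calc s * (2 ^ k * ∫ t in (x - 1 / 2 ^ (k + 1))..(x + 1 / 2 ^ (k + 1)), g t)
      ≤ s * (2 ^ k * (I (l - 1) + I l + I (l + 1))) := by gcongr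
    _ = _ := by field_simp

lemma normD_le {f : ℝ → E} (hf : ContinuousOn f (Set.Icc 0 1)) :
    normD f ≤ ENNReal.ofReal 6 * normFrakD f := by
  refine iSup_le fun j ↦ iSup₂_le fun k hk ↦ ?_
  have hA := two_zpow_sub_pos k j
  refine (orliczNorm_le_mul hA (two_zpow_sub_le_one hk) (c := 2) (K := 2) (by norm_num)
    (by norm_num) fun r hr ↦ modular_dyadicAvg_le hA (by positivity) hr j k hf).trans ?_
  refine mul_le_mul' (ENNReal.ofReal_le_ofReal ?_) ?_
  · have : √2 ≤ 2 := by rw [Real.sqrt_le_iff]; norm_num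
    linarith
  · exact le_iSup_of_le j (le_iSup₂_of_le k hk le_rfl)

lemma normFrakD_le {f : ℝ → E} (hf : ContinuousOn f (Set.Icc 0 1)) :
    normFrakD f ≤ ENNReal.ofReal 6 * normD f := by
  refine iSup_le fun j ↦ iSup₂_le fun k hk ↦ ?_
  have hA := two_zpow_sub_pos k j
  refine (orliczNorm_le_mul hA (two_zpow_sub_le_one hk) (c := 3) (K := 3) (by norm_num)
    (by norm_num) fun r hr ↦ modular_centeredAvg_le hA (by positivity) hr j k hf).trans ?_
  refine mul_le_mul' (ENNReal.ofReal_le_ofReal ?_) ?_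
  · have : √3 ≤ 2 := by rw [Real.sqrt_le_iff]; norm_num
    linarith
  · exact le_iSup_of_le j (le_iSup₂_of_le k hk le_rfl)

end Equivalence

open ProbabilityTheory

/-! ### Second differences of Brownian motion as independent standard Gaussians -/

section SecondDifferences

variable {Ω : Type*} [MeasurableSpace Ω] {P : Measure Ω}

/-- A Brownian motion is indistinguishable from a process all of whose paths are continuous and all
of whose marginals are measurable. -/
lemma exists_continuous_measurable_version {W : NNReal → Ω → ℝ} (hW : IsBrownianReal W P) :
    ∃ B : NNReal → Ω → ℝ, IsPreBrownianReal B P ∧ (∀ t, Measurable (B t)) ∧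
      (∀ ω, Continuous (B · ω)) ∧ ∀ᵐ ω ∂P, ∀ t, W t ω = B t ω := by
  classical
  set q := TopologicalSpace.denseSeq NNReal
  have hm := hW.toIsPreBrownianReal.aemeasurable
  have hae : ∀ᵐ ω ∂P, Continuous (W · ω) ∧ ∀ n, W (q n) ω = (hm (q n)).mk (W (q n)) ω :=
    hW.cont.and (ae_all_iff.2 fun n ↦ (hm (q n)).ae_eq_mk)
  -- The process is set to zero off a measurable set of full measure, on which the paths are
  -- continuous and agree with measurable versions at a dense sequence of times.
  obtain ⟨G, hGae, hGm, hGsub⟩ := hae.exists_measurable_mem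
  have hGae' : ∀ᵐ ω ∂P, ω ∈ G := hGae
  set B : NNReal → Ω → ℝ := fun t ↦ G.indicator (W t) with hB
  have hBW : ∀ᵐ ω ∂P, ∀ t, W t ω = B t ω := by
    filter_upwards [hGae'] with ω hω t
    rw [hB]
    simp only
    rw [Set.indicator_of_mem hω]
  have hcont : ∀ ω, Continuous (B · ω) := by
    intro ω
    by_cases hω : ω ∈ G
    · have : (B · ω) = (W · ω) := by
        ext t; simp only [hB]; rw [Set.indicator_of_mem hω]
      rw [this]
      exact (hGsub ω hω).1
    · have : (B · ω) = fun _ ↦ 0 := by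
        ext t; simp only [hB]; rw [Set.indicator_of_notMem hω]
      rw [this]
      exact continuous_const
  refine ⟨B, hW.toIsPreBrownianReal.congr fun t ↦ hBW.mono fun ω h ↦ h t, fun t ↦ ?_, hcont, hBW⟩
  have hq : ∀ n, Measurable (B (q n)) := by
    intro n
    have : B (q n) = G.indicator ((hm (q n)).mk (W (q n))) := by
      ext ω
      by_cases hω : ω ∈ G
      · simp only [hB]
        rw [Set.indicator_of_mem hω, Set.indicator_of_mem hω]
        exact (hGsub ω hω).2 n
      · simp only [hB]
        rw [Set.indicator_of_notMem hω, Set.indicator_of_notMem hω]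
    rw [this]
    exact (hm (q n)).measurable_mk.indicator hGm
  -- By path continuity, `B t` is a pointwise limit of its values along the dense sequence.
  have ht : t ∈ closure (Set.range q) := TopologicalSpace.denseRange_denseSeq NNReal t
  obtain ⟨x, hx, hxt⟩ := mem_closure_iff_seq_limit.1 ht
  refine measurable_of_tendsto_metrizable (f := fun n ↦ B (x n)) (fun n ↦ ?_) ?_
  · obtain ⟨m, hm'⟩ := hx n
    rw [← hm']
    exact hq m
  · rw [tendsto_pi_nhds]
    exact fun ω ↦ ((hcont ω).tendsto t).comp hxt

lemma covariance_fun_add_left [IsFiniteMeasure P] {X Y Z : Ω → ℝ} (hX : MemLp X 2 P)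
    (hY : MemLp Y 2 P) (hZ : MemLp Z 2 P) :
    cov[fun ω ↦ X ω + Y ω, Z; P] = cov[X, Z; P] + cov[Y, Z; P] :=
  covariance_add_left hX hY hZ

lemma covariance_fun_add_right [IsFiniteMeasure P] {X Y Z : Ω → ℝ} (hX : MemLp X 2 P)
    (hY : MemLp Y 2 P) (hZ : MemLp Z 2 P) :
    cov[X, fun ω ↦ Y ω + Z ω; P] = cov[X, Y; P] + cov[X, Z; P] :=
  covariance_add_right hX hY hZ

/-- The second order difference of step `2 ^ (-j-1)` starting at `t`, scaled by `2 ^ (j/2)`. -/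
noncomputable def scaledDiff (j : ℕ) (w : NNReal → ℝ) (t : NNReal) : ℝ :=
  (2 : ℝ) ^ ((j : ℝ) / 2) *
    (w (t + 2 * (1 / 2 ^ (j + 1))) - 2 * w (t + 1 / 2 ^ (j + 1)) + w t)

variable {B : NNReal → Ω → ℝ}

lemma covariance_scaledDiff (hB : IsPreBrownianReal B P) (j : ℕ) (s t : NNReal) :
    cov[fun ω ↦ scaledDiff j (B · ω) s, fun ω ↦ scaledDiff j (B · ω) t; P] =
      2 ^ j * (let h : NNReal := 1 / 2 ^ (j + 1)
        let K : NNReal → ℝ := fun a ↦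
          (min a (t + 2 * h) : NNReal) - 2 * (min a (t + h) : NNReal) + (min a t : NNReal)
        K (s + 2 * h) - 2 * K (s + h) + K s) := by
  have := hB.isGaussianProcess.isProbabilityMeasure
  have hL : ∀ t, MemLp (fun ω ↦ B t ω) 2 P := fun t ↦
    (hB.isGaussianProcess.hasGaussianLaw_eval t).memLp_two
  have hpow : (2 : ℝ) ^ ((j : ℝ) / 2) * 2 ^ ((j : ℝ) / 2) = 2 ^ j := by
    rw [← Real.rpow_add (by norm_num), add_halves, Real.rpow_natCast]
  set h : NNReal := 1 / 2 ^ (j + 1) with hh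
  have h2 : ∀ t, MemLp (fun ω ↦ 2 * B t ω) 2 P := fun t ↦ (hL t).const_mul 2
  have h3 : ∀ s t, MemLp (fun ω ↦ B s ω - 2 * B t ω) 2 P := fun s t ↦ (hL s).sub (h2 t)
  have h4 : ∀ r s t, MemLp (fun ω ↦ B r ω - 2 * B s ω + B t ω) 2 P :=
    fun r s t ↦ (h3 r s).add (hL t)
  have key : ∀ a, cov[fun ω ↦ B a ω,
      fun ω ↦ B (t + 2 * h) ω - 2 * B (t + h) ω + B t ω; P] =
      (min a (t + 2 * h) : NNReal) - 2 * (min a (t + h) : NNReal) + (min a t : NNReal) := by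
    intro a
    rw [covariance_fun_add_right (hL a) (h3 (t + 2 * h) (t + h)) (hL t),
      covariance_fun_sub_right (hL _) (hL _) (h2 _), covariance_const_mul_right,
      hB.covariance_fun_eval, hB.covariance_fun_eval, hB.covariance_fun_eval]
  unfold scaledDiff
  rw [covariance_const_mul_left, covariance_const_mul_right, ← mul_assoc, hpow]
  congr 1
  rw [covariance_fun_add_left (h3 (s + 2 * h) (s + h)) (hL s) (h4 (t + 2 * h) (t + h) t),
    covariance_fun_sub_left (hL _) (h2 _) (h4 _ _ _), covariance_const_mul_left,
    key, key, key]

/-- Every time `a` occurring in the first difference precedes `t`, so `min a (t + b) = a` does not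
depend on `b`, and the second difference in `b` annihilates it. -/
lemma covariance_scaledDiff_of_le (hB : IsPreBrownianReal B P) {j : ℕ} {s t : NNReal}
    (hst : s + 2 * (1 / 2 ^ (j + 1)) ≤ t) :
    cov[fun ω ↦ scaledDiff j (B · ω) s, fun ω ↦ scaledDiff j (B · ω) t; P] = 0 := by
  rw [covariance_scaledDiff hB]
  simp only
  set h : NNReal := 1 / 2 ^ (j + 1)
  have h0 : 0 ≤ h := zero_le
  have e1 : ∀ b, min (s + 2 * h) (t + b) = s + 2 * h := fun b ↦
    min_eq_left (hst.trans (le_add_of_nonneg_right zero_le))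
  have hs1 : s + h ≤ s + 2 * h := by
    gcongr; rw [two_mul]; exact le_add_of_nonneg_right h0
  have e2 : ∀ b, min (s + h) (t + b) = s + h := fun b ↦
    min_eq_left (hs1.trans (hst.trans (le_add_of_nonneg_right zero_le)))
  have e3 : ∀ b, min s (t + b) = s := fun b ↦
    min_eq_left ((le_add_of_nonneg_right zero_le).trans
      (hst.trans (le_add_of_nonneg_right zero_le)))
  have f1 := e1 0
  have f2 := e2 0
  have f3 := e3 0
  rw [add_zero] at f1 f2 f3
  rw [e1, e1, f1, e2, e2, f2, e3, e3, f3]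
  ring

lemma isGaussianProcess_scaledDiff (hB : IsPreBrownianReal B P) (j : ℕ) {T : Type*}
    (t : T → NNReal) : IsGaussianProcess (fun m ω ↦ scaledDiff j (B · ω) (t m)) P := by
  classical
  refine hB.isGaussianProcess.of_isGaussianProcess fun m ↦
    ⟨{t m, t m + 1 / 2 ^ (j + 1), t m + 2 * (1 / 2 ^ (j + 1))},
      { toFun x := (2 : ℝ) ^ ((j : ℝ) / 2) *
          (x ⟨t m + 2 * (1 / 2 ^ (j + 1)), by simp⟩ - 2 * x ⟨t m + 1 / 2 ^ (j + 1), by simp⟩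
            + x ⟨t m, by simp⟩)
        map_add' x y := by simp; ring
        map_smul' c x := by simp; ring }, fun ω ↦ rfl⟩

lemma hasLaw_scaledDiff (hB : IsPreBrownianReal B P) (j : ℕ) (t : NNReal) :
    HasLaw (fun ω ↦ scaledDiff j (B · ω) t) (gaussianReal 0 1) P := by
  have := hB.isGaussianProcess.isProbabilityMeasure
  have hG := (isGaussianProcess_scaledDiff hB j (fun _ : Unit ↦ t)).hasGaussianLaw_eval ()
  refine ⟨hG.aemeasurable, ?_⟩
  rw [hG.map_eq_gaussianReal]
  have hi := hB.integrable_eval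
  congr 1
  · unfold scaledDiff
    have hi2 : ∀ s, Integrable (fun ω ↦ 2 * B s ω) P := fun s ↦ (hi s).const_mul 2
    have hi3 : ∀ r s, Integrable (fun ω ↦ B r ω - 2 * B s ω) P := fun r s ↦ (hi r).sub (hi2 s)
    rw [integral_const_mul, integral_add (hi3 _ _) (hi _), integral_sub (hi _) (hi2 _),
      integral_const_mul, hB.integral_eval,
      hB.integral_eval, hB.integral_eval]
    simp
  -- With `h = 2^{-j-1}` the twice-differenced kernel equals `2h`, and `2^j · 2h = 1`.
  · rw [← covariance_self hG.aemeasurable, covariance_scaledDiff hB]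
    simp only
    set h : NNReal := 1 / 2 ^ (j + 1) with hh
    have h0 : 0 ≤ h := zero_le
    have hs1 : t + h ≤ t + 2 * h := by
      gcongr; rw [two_mul]; exact le_add_of_nonneg_right h0
    have hs0 : t ≤ t + h := le_add_of_nonneg_right h0
    rw [min_self, min_self, min_self, min_eq_right hs1, min_eq_right (hs0.trans hs1),
      min_eq_left hs1, min_eq_right hs0, min_eq_left hs0, min_eq_left (hs0.trans hs1)]
    push_cast
    have : (h : ℝ) = 1 / 2 ^ (j + 1) := by rw [hh]; push_cast; rfl
    rw [this, pow_succ]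
    rw [← Real.toNNReal_one]
    congr 1
    field_simp
    ring

/-- For a jointly Gaussian family, vanishing covariances give independence; the criterion for blocks
of variables is applied with one-element blocks. -/
lemma iIndepFun_scaledDiff (hB : IsPreBrownianReal B P) (j : ℕ) {t : ℕ → NNReal}
    (ht : ∀ m n, m < n → t m + 2 * (1 / 2 ^ (j + 1)) ≤ t n) :
    iIndepFun (fun m ω ↦ scaledDiff j (B · ω) (t m)) P := by
  have h := IsGaussianProcess.iIndepFun_of_covariance_eq_zero (P := P) (S := fun _ : ℕ ↦ Unit)
    (X := fun m _ ω ↦ scaledDiff j (B · ω) (t m))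
    (isGaussianProcess_scaledDiff hB j (fun p : (_ : ℕ) × Unit ↦ t p.1))
    (fun m _ ↦ (hasLaw_scaledDiff hB j (t m)).aemeasurable) ?_
  · exact h.comp (fun _ x ↦ x ()) fun _ ↦ by fun_prop
  · intro m n hmn _ _
    rcases lt_or_gt_of_ne hmn with h | h
    · exact covariance_scaledDiff_of_le hB (ht m n h)
    · rw [covariance_comm]
      exact covariance_scaledDiff_of_le hB (ht n m h)

end SecondDifferences

/-! ### Exponential moments of a squared Gaussian -/

section Moments

lemma gaussianPDFReal_mul_exp (a x : ℝ) :
    gaussianPDFReal 0 1 x • Real.exp (a * x ^ 2) =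
      (√(2 * Real.pi))⁻¹ * Real.exp (-(1 / 2 - a) * x ^ 2) := by
  simp only [gaussianPDFReal, NNReal.coe_one, mul_one, sub_zero, smul_eq_mul, mul_assoc]
  rw [← Real.exp_add]
  congr 2
  ring

lemma integrable_exp_mul_sq_gaussianReal {a : ℝ} (ha : a < 1 / 2) :
    Integrable (fun x ↦ Real.exp (a * x ^ 2)) (gaussianReal 0 1) := by
  rw [gaussianReal_of_var_ne_zero 0 one_ne_zero,
    integrable_withDensity_iff_integrable_smul' (measurable_gaussianPDF 0 1)
      (Filter.Eventually.of_forall fun x ↦ ENNReal.ofReal_lt_top)]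
  have : (fun x ↦ (gaussianPDF 0 1 x).toReal • Real.exp (a * x ^ 2)) =
      fun x ↦ (√(2 * Real.pi))⁻¹ * Real.exp (-(1 / 2 - a) * x ^ 2) := by
    ext x
    rw [← gaussianPDFReal_mul_exp, toReal_gaussianPDF]
  rw [this]
  exact (integrable_exp_neg_mul_sq (by linarith)).const_mul _

lemma integral_exp_mul_sq_gaussianReal {a : ℝ} (ha : a < 1 / 2) :
    ∫ x, Real.exp (a * x ^ 2) ∂gaussianReal 0 1 = √(1 / (1 - 2 * a)) := by
  rw [integral_gaussianReal_eq_integral_smul one_ne_zero]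
  simp_rw [gaussianPDFReal_mul_exp]
  rw [integral_const_mul, integral_gaussian, ← Real.sqrt_inv, ← Real.sqrt_mul (by positivity)]
  congr 1
  have : 1 - 2 * a ≠ 0 := by linarith
  have : 1 / 2 - a ≠ 0 := by linarith
  have := Real.pi_pos
  field_simp

end Moments

/-! ### Mean and variance of the block exponentials -/

section BlockMean

/-- The exponential of one eighth of the sum of squares over the `l`-th block of length `N`. -/
noncomputable def blockExp (N : ℕ) (x : ℕ → ℝ) (l : ℕ) : ℝ :=
  Real.exp (1 / 8 * ∑ m ∈ Finset.Ico (l * N) ((l + 1) * N), x m ^ 2)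

/-- The mean of `blockExp` over the first `2 ^ k` blocks. -/
noncomputable def blockMean (k N : ℕ) (x : ℕ → ℝ) : ℝ :=
  1 / 2 ^ k * ∑ l ∈ Finset.range (2 ^ k), blockExp N x l

lemma blockMean_nonneg (k N : ℕ) (x : ℕ → ℝ) : 0 ≤ blockMean k N x :=
  mul_nonneg (by positivity) (Finset.sum_nonneg fun _ _ ↦ (Real.exp_pos _).le)

lemma measurable_blockExp (N l : ℕ) : Measurable fun x ↦ blockExp N x l := by
  unfold blockExp
  fun_prop

lemma measurable_blockMean (k N : ℕ) : Measurable (blockMean k N) := by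
  unfold blockMean
  have := measurable_blockExp N
  fun_prop

variable {Ω : Type*} [MeasurableSpace Ω] {P : Measure Ω} {X : ℕ → Ω → ℝ}

lemma integrable_exp_sum_sq [IsProbabilityMeasure P] (hi : iIndepFun X P)
    (hm : ∀ m, Measurable (X m))
    (hl : ∀ m, HasLaw (X m) (gaussianReal 0 1) P) {a : ℝ} (ha : a < 1 / 2) (S : Finset ℕ) :
    Integrable (fun ω ↦ Real.exp (a * ∑ m ∈ S, X m ω ^ 2)) P := by
  have hi' := hi.comp (fun _ x ↦ x ^ 2) fun _ ↦ by fun_prop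
  have := hi'.integrable_exp_mul_sum (t := a) (s := S) (fun m ↦ (hm m).pow_const 2) fun m _ ↦ by
    have h := integrable_exp_mul_sq_gaussianReal ha
    rw [← (hl m).map_eq] at h
    exact h.comp_measurable (hm m)
  simpa [Finset.sum_apply] using this

lemma integral_exp_sum_sq (hi : iIndepFun X P) (hm : ∀ m, Measurable (X m))
    (hl : ∀ m, HasLaw (X m) (gaussianReal 0 1) P) {a : ℝ} (ha : a < 1 / 2) (S : Finset ℕ) :
    ∫ ω, Real.exp (a * ∑ m ∈ S, X m ω ^ 2) ∂P = √(1 / (1 - 2 * a)) ^ S.card := by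
  have hi' := hi.comp (fun _ x ↦ x ^ 2) fun _ ↦ by fun_prop
  have h1 := hi'.mgf_sum (t := a) (fun m ↦ (hm m).pow_const 2) S
  have h2 : ∀ m ∈ S, mgf ((fun x : ℝ ↦ x ^ 2) ∘ X m) P a = √(1 / (1 - 2 * a)) := by
    intro m _
    rw [← integral_exp_mul_sq_gaussianReal ha]
    exact (hl m).integral_comp (f := fun x ↦ Real.exp (a * x ^ 2))
      (by fun_prop)
  rw [Finset.prod_congr rfl h2, Finset.prod_const] at h1
  rw [← h1]
  simp [mgf, Finset.sum_apply]

lemma blockExp_sq (N : ℕ) (x : ℕ → ℝ) (l : ℕ) :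
    blockExp N x l ^ 2 = Real.exp (1 / 4 * ∑ m ∈ Finset.Ico (l * N) ((l + 1) * N), x m ^ 2) := by
  rw [blockExp, ← Real.exp_nat_mul]
  congr 1
  push_cast
  ring

lemma memLp_blockExp [IsProbabilityMeasure P] (hi : iIndepFun X P) (hm : ∀ m, Measurable (X m))
    (hl : ∀ m, HasLaw (X m) (gaussianReal 0 1) P) (N l : ℕ) :
    MemLp (fun ω ↦ blockExp N (fun m ↦ X m ω) l) 2 P := by
  rw [memLp_two_iff_integrable_sq]
  · simp_rw [blockExp_sq]
    exact integrable_exp_sum_sq hi hm hl (by norm_num) _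
  · exact ((measurable_blockExp N l).comp (measurable_pi_lambda _ hm)).aestronglyMeasurable

lemma card_Ico_block (N l : ℕ) : (Finset.Ico (l * N) ((l + 1) * N)).card = N := by
  rw [Nat.card_Ico, add_mul, one_mul, Nat.add_sub_cancel_left]

lemma integral_blockExp (hi : iIndepFun X P) (hm : ∀ m, Measurable (X m))
    (hl : ∀ m, HasLaw (X m) (gaussianReal 0 1) P) (N l : ℕ) :
    ∫ ω, blockExp N (fun m ↦ X m ω) l ∂P = √(4 / 3) ^ N := by
  have := integral_exp_sum_sq hi hm hl (a := 1 / 8) (by norm_num)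
    (Finset.Ico (l * N) ((l + 1) * N))
  rw [card_Ico_block] at this
  unfold blockExp
  rw [this]
  norm_num

/-- Squaring doubles the exponent from 1/8 to 1/4, still below the threshold 1/2, so the second
moment is finite: each variable contributes `√(1 / (1 - 2/4)) = √2`. -/
lemma variance_blockExp_le [IsProbabilityMeasure P] (hi : iIndepFun X P)
    (hm : ∀ m, Measurable (X m))
    (hl : ∀ m, HasLaw (X m) (gaussianReal 0 1) P) (N l : ℕ) :
    Var[fun ω ↦ blockExp N (fun m ↦ X m ω) l; P] ≤ √2 ^ N := by
  refine (variance_le_expectation_sq (memLp_blockExp hi hm hl N l).aestronglyMeasurable).trans ?_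
  have := integral_exp_sum_sq hi hm hl (a := 1 / 4) (by norm_num)
    (Finset.Ico (l * N) ((l + 1) * N))
  rw [card_Ico_block] at this
  simp only [Pi.pow_apply, blockExp_sq]
  rw [this]
  norm_num

lemma indepFun_blockExp (hi : iIndepFun X P) (hm : ∀ m, Measurable (X m)) (N : ℕ) {l l' : ℕ}
    (hll : l ≠ l') :
    IndepFun (fun ω ↦ blockExp N (fun m ↦ X m ω) l) (fun ω ↦ blockExp N (fun m ↦ X m ω) l') P := by
  have hdisj : Disjoint (Finset.Ico (l * N) ((l + 1) * N)) (Finset.Ico (l' * N) ((l' + 1) * N)) := by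
    rw [Finset.disjoint_left]
    intro m h h'
    rw [Finset.mem_Ico] at h h'
    have h1 : l < l' + 1 := lt_of_mul_lt_mul_right (h.1.trans_lt h'.2) (Nat.zero_le _)
    have h2 : l' < l + 1 := lt_of_mul_lt_mul_right (h'.1.trans_lt h.2) (Nat.zero_le _)
    omega
  have h := hi.indepFun_finset _ _ hdisj hm
  have hφ : ∀ S : Finset ℕ, Measurable fun y : S → ℝ ↦ Real.exp (1 / 8 * ∑ m, y m ^ 2) := by
    intro S
    fun_prop
  have h' := h.comp (hφ _) (hφ _)
  convert h' using 1 <;>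
  · ext ω
    simp only [blockExp, Function.comp]
    rw [← Finset.sum_coe_sort]

/-- Distinct blocks are independent, so variances add, and averaging over `2 ^ k` of them gains the
factor `2^{-k}` needed for summability in `k`. -/
lemma lintegral_blockMean_sub_sq_le [IsProbabilityMeasure P] (hi : iIndepFun X P)
    (hm : ∀ m, Measurable (X m))
    (hl : ∀ m, HasLaw (X m) (gaussianReal 0 1) P) (k N : ℕ) :
    ∫⁻ ω, ENNReal.ofReal ((blockMean k N (fun m ↦ X m ω) - √(4 / 3) ^ N) ^ 2) ∂P ≤
      ENNReal.ofReal (√2 ^ N / 2 ^ k) := by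
  set Z : ℕ → Ω → ℝ := fun l ω ↦ blockExp N (fun m ↦ X m ω) l with hZ
  have hZ2 : ∀ l, MemLp (Z l) 2 P := memLp_blockExp hi hm hl N
  set T : Ω → ℝ := fun ω ↦ blockMean k N (fun m ↦ X m ω) with hT
  have hTe : T = fun ω ↦ 1 / 2 ^ k * (∑ l ∈ Finset.range (2 ^ k), Z l) ω := by
    ext ω
    simp only [hT, blockMean, Finset.sum_apply, hZ]
  have hsum : MemLp (∑ l ∈ Finset.range (2 ^ k), Z l) 2 P := memLp_finsetSum' _ fun l _ ↦ hZ2 l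
  have hT2 : MemLp T 2 P := by
    rw [hTe]
    exact hsum.const_mul _
  have hmean : ∫ ω, T ω ∂P = √(4 / 3) ^ N := by
    rw [hTe, integral_const_mul]
    simp_rw [Finset.sum_apply]
    rw [integral_finsetSum _ fun l _ ↦ (hZ2 l).integrable (by norm_num),
      Finset.sum_congr rfl fun l _ ↦ integral_blockExp hi hm hl N l]
    simp
  have hvar : Var[T; P] ≤ √2 ^ N / 2 ^ k := by
    rw [hTe, variance_const_mul, IndepFun.variance_sum (fun l _ ↦ hZ2 l)
      fun l _ l' _ h ↦ indepFun_blockExp hi hm N h]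
    calc (1 / 2 ^ k : ℝ) ^ 2 * ∑ l ∈ Finset.range (2 ^ k), Var[Z l; P]
        ≤ (1 / 2 ^ k : ℝ) ^ 2 * ∑ l ∈ Finset.range (2 ^ k), √2 ^ N := by
          gcongr with l _
          exact variance_blockExp_le hi hm hl N l
      _ = _ := by
          rw [Finset.sum_const, Finset.card_range, nsmul_eq_mul]
          push_cast
          field_simp
  rw [← hmean, ← evariance_eq_lintegral_ofReal, ← hT2.ofReal_variance_eq]
  exact ENNReal.ofReal_le_ofReal hvar

end BlockMean

/-! ### Deterministic modular bounds for a continuous path -/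

section Path

/-- The scaled second order differences along the grid `(m + u) / 2 ^ j`. -/
noncomputable def gridDiff (j : ℕ) (w : NNReal → ℝ) (u : ℝ) (m : ℕ) : ℝ :=
  scaledDiff j w (((m : ℝ) + u) / 2 ^ j).toNNReal

variable {w : NNReal → ℝ}

lemma continuous_scaledDiff (hw : Continuous w) (j : ℕ) : Continuous (scaledDiff j w) := by
  unfold scaledDiff
  fun_prop

lemma continuous_gridDiff (hw : Continuous w) (j m : ℕ) :
    Continuous fun u ↦ gridDiff j w u m :=
  (continuous_scaledDiff hw j).comp (by fun_prop)

lemma continuous_blockExp_gridDiff (hw : Continuous w) (j N l : ℕ) :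
    Continuous fun u ↦ blockExp N (gridDiff j w u) l := by
  have := continuous_gridDiff hw j
  unfold blockExp
  fun_prop

lemma continuous_blockMean_gridDiff (hw : Continuous w) (j k N : ℕ) :
    Continuous fun u ↦ blockMean k N (gridDiff j w u) := by
  have := continuous_blockExp_gridDiff hw j N
  unfold blockMean
  fun_prop

/-- Dropping the cutoff at the right end of `[0,1]` only increases the absolute value, and leaves a
full grid of Gaussian variables. -/
lemma norm_secondDiff_le_scaledDiff (j : ℕ) (w : NNReal → ℝ) (t : ℝ) :
    (2 : ℝ) ^ ((j : ℝ) / 2) * ‖secondDiff (1 / 2 ^ (j + 1)) (fun t : ℝ ↦ w t.toNNReal) t‖ ≤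
      |scaledDiff j w t.toNNReal| := by
  unfold secondDiff
  split_ifs with h
  · have e : ((1 : ℝ) / 2 ^ (j + 1)).toNNReal = 1 / 2 ^ (j + 1) := by
      rw [show (1 : ℝ) / 2 ^ (j + 1) = ((1 / 2 ^ (j + 1) : NNReal) : ℝ) by push_cast; rfl,
        Real.toNNReal_coe]
    have e2 : ((2 : ℝ) * (1 / 2 ^ (j + 1))).toNNReal = 2 * (1 / 2 ^ (j + 1)) := by
      rw [Real.toNNReal_mul (by norm_num), e]
      simp
    beta_reduce
    rw [Real.toNNReal_add h.1.1 (by positivity), Real.toNNReal_add h.1.1 (by positivity), e, e2]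
    unfold scaledDiff
    rw [abs_mul, abs_of_nonneg (by positivity : (0 : ℝ) ≤ 2 ^ ((j : ℝ) / 2)), Real.norm_eq_abs,
      nsmul_eq_mul]
    push_cast
    exact le_rfl
  · simp

/-- The cell splits into `2 ^ n` intervals of length `2^{-(k+n)}`, and `t = (m + u) / 2^(k+n)` maps
each to `u ∈ [0,1]`. For a fixed `u` the samples no longer overlap. -/
lemma scaled_average_le (hw : Continuous w) (k n l : ℕ) :
    (2 : ℝ) ^ (((k + n : ℕ) : ℝ) / 2) * (2 ^ k *
      ∫ t in ((l : ℝ) / 2 ^ k)..(((l : ℝ) + 1) / 2 ^ k),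
        ‖secondDiff (1 / 2 ^ (k + n + 1)) (fun t : ℝ ↦ w t.toNNReal) t‖) ≤
    ∫ u in (0 : ℝ)..1, 1 / 2 ^ n *
      ∑ m ∈ Finset.Ico (l * 2 ^ n) ((l + 1) * 2 ^ n), |gridDiff (k + n) w u m| := by
  have hfc : ContinuousOn (fun t : ℝ ↦ w t.toNNReal) (Set.Icc 0 1) :=
    (hw.comp continuous_real_toNNReal).continuousOn
  have hgi := integrable_norm_secondDiff (h := 1 / 2 ^ (k + n + 1)) (by positivity) hfc
  set G : ℝ → ℝ := fun t ↦ |scaledDiff (k + n) w t.toNNReal| with hG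
  have hGc : Continuous G := ((continuous_scaledDiff hw _).comp continuous_real_toNNReal).abs
  have h1 : (2 : ℝ) ^ (((k + n : ℕ) : ℝ) / 2) * ∫ t in ((l : ℝ) / 2 ^ k)..(((l : ℝ) + 1) / 2 ^ k),
      ‖secondDiff (1 / 2 ^ (k + n + 1)) (fun t : ℝ ↦ w t.toNNReal) t‖ ≤
      ∫ t in ((l : ℝ) / 2 ^ k)..(((l : ℝ) + 1) / 2 ^ k), G t := by
    rw [← intervalIntegral.integral_const_mul]
    exact intervalIntegral.integral_mono (by gcongr; linarith)
      (hgi.intervalIntegrable.const_mul _) (hGc.intervalIntegrable _ _)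
      fun t ↦ norm_secondDiff_le_scaledDiff _ _ _
  have h2 : ∫ t in ((l : ℝ) / 2 ^ k)..(((l : ℝ) + 1) / 2 ^ k), G t =
      ∑ m ∈ Finset.Ico (l * 2 ^ n) ((l + 1) * 2 ^ n),
        ∫ t in ((m : ℝ) / 2 ^ (k + n))..(((m : ℝ) + 1) / 2 ^ (k + n)), G t := by
    have := intervalIntegral.sum_integral_adjacent_intervals_Ico (f := G) (μ := volume)
      (a := fun m : ℕ ↦ (m : ℝ) / 2 ^ (k + n)) (m := l * 2 ^ n) (n := (l + 1) * 2 ^ n)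
      (by gcongr; omega) fun m _ ↦ hGc.intervalIntegrable _ _
    push_cast at this
    rw [this, pow_add, mul_div_mul_right _ _ (by positivity), mul_div_mul_right _ _ (by positivity)]
  have h3 : ∀ m : ℕ, ∫ t in ((m : ℝ) / 2 ^ (k + n))..(((m : ℝ) + 1) / 2 ^ (k + n)), G t =
      1 / 2 ^ (k + n) * ∫ u in (0 : ℝ)..1, |gridDiff (k + n) w u m| := by
    intro m
    have := intervalIntegral.integral_comp_mul_add (a := 0) (b := 1) (c := 1 / 2 ^ (k + n)) G
      (by positivity) ((m : ℝ) / 2 ^ (k + n))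
    rw [smul_eq_mul, mul_zero, zero_add, mul_one, ← add_div, add_comm 1 (m : ℝ)] at this
    have e : ∀ u : ℝ, |gridDiff (k + n) w u m| = G (1 / 2 ^ (k + n) * u + (m : ℝ) / 2 ^ (k + n)) := by
      intro u
      simp only [hG, gridDiff]
      congr 3
      ring
    simp_rw [e]
    rw [this, ← mul_assoc, mul_inv_cancel₀ (by positivity), one_mul]
  rw [intervalIntegral.integral_const_mul, intervalIntegral.integral_finsetSum
    fun m _ ↦ (continuous_gridDiff hw _ m).abs.intervalIntegrable _ _]
  calc _ = 2 ^ k * ((2 : ℝ) ^ (((k + n : ℕ) : ℝ) / 2) *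
        ∫ t in ((l : ℝ) / 2 ^ k)..(((l : ℝ) + 1) / 2 ^ k),
          ‖secondDiff (1 / 2 ^ (k + n + 1)) (fun t : ℝ ↦ w t.toNNReal) t‖) := by ring
    _ ≤ 2 ^ k * ∫ t in ((l : ℝ) / 2 ^ k)..(((l : ℝ) + 1) / 2 ^ k), G t := by gcongr
    _ = _ := by
      rw [h2, Finset.sum_congr rfl fun m _ ↦ h3 m, ← Finset.mul_sum, ← mul_assoc, pow_add]
      congr 1
      field_simp

/-- Jensen for the convex function `exp (N y² / 8)` moves the integral over `u` outside;
Cauchy–Schwarz over the `N` samples then cancels the factor `N`. -/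
lemma exp_sq_average_le (hw : Continuous w) (j N l : ℕ) (hN : 0 < N) {y : ℝ} (hy : 0 ≤ y)
    (h : y ≤ ∫ u in (0 : ℝ)..1, 1 / (N : ℝ) *
      ∑ m ∈ Finset.Ico (l * N) ((l + 1) * N), |gridDiff j w u m|) :
    Real.exp (N / 8 * y ^ 2) ≤ ∫ u in (0 : ℝ)..1, blockExp N (gridDiff j w u) l := by
  have hN0 : (0 : ℝ) < N := by exact_mod_cast hN
  set V : ℝ → ℝ := fun u ↦ 1 / (N : ℝ) *
    ∑ m ∈ Finset.Ico (l * N) ((l + 1) * N), |gridDiff j w u m| with hV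
  have hVc : Continuous V := by
    have := continuous_gridDiff hw j
    fun_prop
  have hprob : IsProbabilityMeasure (volume.restrict (Set.Ioc (0 : ℝ) 1)) :=
    ⟨by rw [Measure.restrict_apply_univ, Real.volume_Ioc]; norm_num⟩
  have hconv : ConvexOn ℝ Set.univ fun y : ℝ ↦ Real.exp (N / 8 * y ^ 2) := by
    have h1 : ConvexOn ℝ Set.univ fun y : ℝ ↦ (N / 8 : ℝ) * y ^ 2 := by
      simpa [smul_eq_mul] using
        (even_two.convexOn_pow (𝕜 := ℝ)).smul (c := (N / 8 : ℝ)) (by positivity)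
    exact ⟨convex_univ, fun x hx y hy a b ha hb hab ↦
      (Real.exp_le_exp.2 (h1.2 hx hy ha hb hab)).trans
        (convexOn_exp.2 (Set.mem_univ _) (Set.mem_univ _) ha hb hab)⟩
  have hJ := hconv.map_integral_le (μ := volume.restrict (Set.Ioc (0 : ℝ) 1)) (f := V)
    (by fun_prop) isClosed_univ (by simp) hVc.integrableOn_Ioc
    (Continuous.integrableOn_Ioc (by fun_prop))
  rw [← intervalIntegral.integral_of_le zero_le_one,
    ← intervalIntegral.integral_of_le zero_le_one] at hJ
  calc Real.exp (N / 8 * y ^ 2) ≤ Real.exp (N / 8 * (∫ u in (0 : ℝ)..1, V u) ^ 2) := by gcongr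
    _ ≤ ∫ u in (0 : ℝ)..1, Real.exp (N / 8 * V u ^ 2) := hJ
    _ ≤ _ := by
      refine intervalIntegral.integral_mono zero_le_one
        (Continuous.intervalIntegrable (by fun_prop) _ _)
        ((continuous_blockExp_gridDiff hw j N l).intervalIntegrable _ _) fun u ↦ ?_
      simp only [blockExp, hV]
      apply Real.exp_le_exp.2
      have hcs := sq_sum_le_card_mul_sum_sq (s := Finset.Ico (l * N) ((l + 1) * N))
        (f := fun m ↦ |gridDiff j w u m|)
      rw [card_Ico_block] at hcs
      simp only [sq_abs] at hcs
      rw [mul_pow]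
      calc (N : ℝ) / 8 * ((1 / N) ^ 2 *
            (∑ m ∈ Finset.Ico (l * N) ((l + 1) * N), |gridDiff j w u m|) ^ 2)
          ≤ (N : ℝ) / 8 * ((1 / N) ^ 2 *
            (N * ∑ m ∈ Finset.Ico (l * N) ((l + 1) * N), gridDiff j w u m ^ 2)) := by gcongr
        _ = _ := by field_simp

lemma modular_dyadicAvg_path_le (hw : Continuous w) (k n : ℕ) :
    modular ((2 : ℝ) ^ ((k : ℤ) - ((k + n : ℕ) : ℤ))) √8
      (fun x ↦ (2 : ℝ) ^ (((k + n : ℕ) : ℝ) / 2) *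
        dyadicAvg (k + n) k (fun t : ℝ ↦ w t.toNNReal) x) ≤
    ENNReal.ofReal (1 + Real.exp (-(2 ^ n : ℕ)) *
      ∫ u in (0 : ℝ)..1, blockMean k (2 ^ n) (gridDiff (k + n) w u)) := by
  have hA : (2 : ℝ) ^ ((k : ℤ) - ((k + n : ℕ) : ℤ)) = ((2 ^ n : ℕ) : ℝ)⁻¹ := by
    push_cast
    rw [sub_add_cancel_left, zpow_neg, zpow_natCast]
  rw [modular_dyadicAvg _ _ _ (by positivity), hA]
  set N : ℕ := 2 ^ n with hN
  have hN0 : (0 : ℝ) < N := by positivity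
  have hl : ∀ l ∈ Finset.range (2 ^ k), ENNReal.ofReal (youngFun (N : ℝ)⁻¹
      ((2 : ℝ) ^ (((k + n : ℕ) : ℝ) / 2) * (2 ^ k *
        ∫ t in ((l : ℝ) / 2 ^ k)..(((l : ℝ) + 1) / 2 ^ k),
          ‖secondDiff (1 / 2 ^ (k + n + 1)) (fun t : ℝ ↦ w t.toNNReal) t‖) / √8)) *
        ENNReal.ofReal (1 / 2 ^ k) ≤
      ENNReal.ofReal ((1 + Real.exp (-N) *
        ∫ u in (0 : ℝ)..1, blockExp N (gridDiff (k + n) w u) l) * (1 / 2 ^ k)) := by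
    intro l _
    rw [← ENNReal.ofReal_mul (youngFun_nonneg _ _)]
    refine ENNReal.ofReal_le_ofReal (mul_le_mul_of_nonneg_right ?_ (by positivity))
    have h := scaled_average_le hw k n l
    have hnn : 0 ≤ (2 : ℝ) ^ (((k + n : ℕ) : ℝ) / 2) * (2 ^ k *
        ∫ t in ((l : ℝ) / 2 ^ k)..(((l : ℝ) + 1) / 2 ^ k),
          ‖secondDiff (1 / 2 ^ (k + n + 1)) (fun t : ℝ ↦ w t.toNNReal) t‖) := by
      have := intervalIntegral.integral_nonneg (μ := volume)
        (f := fun t ↦ ‖secondDiff (1 / 2 ^ (k + n + 1)) (fun t : ℝ ↦ w t.toNNReal) t‖)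
        (show (l : ℝ) / 2 ^ k ≤ ((l : ℝ) + 1) / 2 ^ k by gcongr; linarith)
        fun _ _ ↦ norm_nonneg _
      positivity
    set y := (2 : ℝ) ^ (((k + n : ℕ) : ℝ) / 2) * (2 ^ k *
        ∫ t in ((l : ℝ) / 2 ^ k)..(((l : ℝ) + 1) / 2 ^ k),
          ‖secondDiff (1 / 2 ^ (k + n + 1)) (fun t : ℝ ↦ w t.toNNReal) t‖)
    -- Since `1/A = N`, scale `√8` makes the exponent `N (y²/8 - 1)`, which yields the damping
    -- factor `exp (-N)`.
    refine (youngFun_le_one_add_exp (by positivity)).trans ?_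
    gcongr
    have h' := exp_sq_average_le hw (k + n) N l (by positivity) hnn (by
      rw [hN]; push_cast; exact h)
    refine le_trans (le_of_eq ?_) (mul_le_mul_of_nonneg_left h' (Real.exp_pos _).le)
    rw [← Real.exp_add, div_pow, Real.sq_sqrt (by norm_num)]
    congr 1
    field_simp
    ring
  refine (Finset.sum_le_sum hl).trans ?_
  have hb : ∀ l, 0 ≤ ∫ u in (0 : ℝ)..1, blockExp N (gridDiff (k + n) w u) l := fun l ↦
    intervalIntegral.integral_nonneg zero_le_one fun _ _ ↦ (Real.exp_pos _).le
  rw [← ENNReal.ofReal_sum_of_nonneg fun l _ ↦ by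
    have := hb l
    positivity]
  refine ENNReal.ofReal_le_ofReal (le_of_eq ?_)
  unfold blockMean
  rw [intervalIntegral.integral_const_mul, intervalIntegral.integral_finsetSum
    fun l _ ↦ (continuous_blockExp_gridDiff hw _ N l).intervalIntegrable _ _,
    ← Finset.sum_mul, Finset.sum_add_distrib, ← Finset.mul_sum]
  simp
  field_simp

/-- The squared deviation of the block means, averaged over the offset `u` of the grid. -/
noncomputable def gridDeviation (k n : ℕ) (w : NNReal → ℝ) : ENNReal :=
  ∫⁻ u in Set.Ioc (0 : ℝ) 1, ENNReal.ofReal (Real.exp (-(2 ^ n : ℕ)) ^ 2) *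
    ENNReal.ofReal ((blockMean k (2 ^ n) (gridDiff (k + n) w u) - √(4 / 3) ^ (2 ^ n)) ^ 2)

lemma sqrt_pow_mul_exp_neg_le_one (N : ℕ) : Real.exp (-N) * √(4 / 3) ^ N ≤ 1 := by
  have h1 : √(4 / 3) ≤ Real.exp 1 := by
    have h2 : √(4 / 3 : ℝ) ≤ 2 := by rw [Real.sqrt_le_iff]; norm_num
    linarith [Real.add_one_le_exp 1]
  have h3 : √(4 / 3) ^ N ≤ Real.exp N := by
    rw [← Real.exp_one_pow]
    gcongr
  rw [Real.exp_neg, inv_mul_le_iff₀ (Real.exp_pos _), mul_one]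
  exact h3

lemma modular_path_le_gridDeviation (hw : Continuous w) (k n : ℕ) :
    modular ((2 : ℝ) ^ ((k : ℤ) - ((k + n : ℕ) : ℤ))) √8
      (fun x ↦ (2 : ℝ) ^ (((k + n : ℕ) : ℝ) / 2) *
        dyadicAvg (k + n) k (fun t : ℝ ↦ w t.toNNReal) x) ≤ 3 + gridDeviation k n w := by
  refine (modular_dyadicAvg_path_le hw k n).trans ?_
  set N : ℕ := 2 ^ n with hN
  set T : ℝ → ℝ := fun u ↦ blockMean k N (gridDiff (k + n) w u) with hT
  have hTc : Continuous T := continuous_blockMean_gridDiff hw _ k N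
  have hTi : ∀ c : ℝ, IntegrableOn (fun u ↦ c * T u) (Set.Ioc 0 1) := fun c ↦
    Continuous.integrableOn_Ioc (by fun_prop)
  have hT0 : ∀ u, 0 ≤ T u := fun u ↦ blockMean_nonneg _ _ _
  rw [← intervalIntegral.integral_const_mul, intervalIntegral.integral_of_le zero_le_one,
    ENNReal.ofReal_add zero_le_one (integral_nonneg fun u ↦ mul_nonneg (Real.exp_pos _).le (hT0 u)),
    ofReal_integral_eq_lintegral_ofReal (hTi _) (Filter.Eventually.of_forall fun u ↦
      mul_nonneg (Real.exp_pos _).le (hT0 u)), ENNReal.ofReal_one,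
    show (3 : ENNReal) = 1 + 2 by norm_num, add_assoc]
  refine add_le_add le_rfl ?_
  have h2 : (2 : ENNReal) = ∫⁻ _ in Set.Ioc (0 : ℝ) 1, 2 := by
    rw [setLIntegral_const, Real.volume_Ioc]
    norm_num
  unfold gridDeviation
  rw [h2, ← lintegral_add_left measurable_const]
  refine lintegral_mono fun u ↦ ?_
  rw [← ENNReal.ofReal_mul (by positivity), show (2 : ENNReal) = ENNReal.ofReal 2 by norm_num,
    ← ENNReal.ofReal_add (by norm_num) (by positivity), ← mul_pow]
  apply ENNReal.ofReal_le_ofReal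
  have h := sqrt_pow_mul_exp_neg_le_one N
  -- The normalized mean is at most 1, and the deviation `d` satisfies `d ≤ 1 + d²`; this gives the
  -- bound `2 + d²`.
  have hsub : Real.exp (-N) * T u =
      Real.exp (-N) * √(4 / 3) ^ N + Real.exp (-N) * (T u - √(4 / 3) ^ N) := by ring
  rw [hsub]
  change _ ≤ 2 + (Real.exp (-N) * (T u - √(4 / 3) ^ N)) ^ 2
  nlinarith [sq_nonneg (Real.exp (-N) * (T u - √(4 / 3) ^ N) - 1),
    sq_nonneg (Real.exp (-N) * (T u - √(4 / 3) ^ N))]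

end Path

/-! ### Summable deviations and almost sure finiteness -/

section Brownian

variable {Ω : Type*} [MeasurableSpace Ω] {P : Measure Ω} {B : NNReal → Ω → ℝ}

lemma lintegral_blockMean_gridDiff_le (hB : IsPreBrownianReal B P) (hm : ∀ t, Measurable (B t))
    (j k N : ℕ) {u : ℝ} (hu : 0 ≤ u) :
    ∫⁻ ω, ENNReal.ofReal ((blockMean k N (gridDiff j (B · ω) u) - √(4 / 3) ^ N) ^ 2) ∂P ≤
      ENNReal.ofReal (√2 ^ N / 2 ^ k) := by
  have := hB.isGaussianProcess.isProbabilityMeasure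
  refine lintegral_blockMean_sub_sq_le (X := fun m ω ↦ gridDiff j (B · ω) u m) ?_ ?_ ?_ k N
  · refine iIndepFun_scaledDiff hB j fun m n hmn ↦ ?_
    -- Two steps of length `2^{-j-1}` equal the grid spacing `2^{-j}`, so consecutive differences
    -- share at most an endpoint.
    have e : 2 * (1 / 2 ^ (j + 1)) = ((1 : ℝ) / 2 ^ j).toNNReal := by
      rw [show (1 : ℝ) / 2 ^ j = ((2 * (1 / 2 ^ (j + 1)) : NNReal) : ℝ) by
        push_cast; rw [pow_succ]; field_simp, Real.toNNReal_coe]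
    rw [e, ← Real.toNNReal_add (by positivity) (by positivity), ← add_div]
    apply Real.toNNReal_le_toNNReal
    have : (m : ℝ) + 1 ≤ n := by exact_mod_cast hmn
    gcongr ?_ / _
    linarith
  · intro m
    unfold gridDiff scaledDiff
    fun_prop
  · exact fun m ↦ hasLaw_scaledDiff hB j _

/-- Joint measurability in the sample point and the offset is what Tonelli's theorem requires; it
comes from path continuity and measurable marginals. -/
lemma measurable_blockMean_gridDiff (hm : ∀ t, Measurable (B t)) (hc : ∀ ω, Continuous (B · ω))
    (j k N : ℕ) : Measurable fun p : Ω × ℝ ↦ blockMean k N (gridDiff j (B · p.1) p.2) := by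
  have hu := measurable_uncurry_of_continuous_of_measurable hc hm
  refine (measurable_blockMean k N).comp (measurable_pi_lambda _ fun m ↦ ?_)
  have key : ∀ τ : ℝ → NNReal, Measurable τ → Measurable fun p : Ω × ℝ ↦ B (τ p.2) p.1 := by
    intro τ hτ
    exact hu.comp ((hτ.comp measurable_snd).prodMk measurable_fst)
  unfold gridDiff scaledDiff
  have hτ : Measurable fun u : ℝ ↦ (((m : ℝ) + u) / 2 ^ j).toNNReal := by fun_prop
  exact (((key _ (hτ.add_const _)).sub ((key _ (hτ.add_const _)).const_mul 2)).add
    (key _ hτ)).const_mul _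

/-- One factor `exp (-N)` absorbs `√2 ^ N`; the other is at most `1 / N = 2^{-n}`. -/
lemma exp_neg_sq_mul_le (k n : ℕ) :
    Real.exp (-(2 ^ n : ℕ)) ^ 2 * (√2 ^ (2 ^ n) / 2 ^ k) ≤ (1 / 2) ^ k * (1 / 2) ^ n := by
  set N : ℕ := 2 ^ n with hN
  have h1 : √2 ≤ Real.exp 1 := by
    have h2 : √(2 : ℝ) ≤ 2 := by rw [Real.sqrt_le_iff]; norm_num
    linarith [Real.add_one_le_exp 1]
  have h3 : √2 ^ N ≤ Real.exp N := by
    rw [← Real.exp_one_pow]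
    gcongr
  have h4 : Real.exp (-N) ≤ (1 / 2) ^ n := by
    have : (N : ℝ) ≤ Real.exp N := by linarith [Real.add_one_le_exp (N : ℝ)]
    rw [Real.exp_neg, one_div, inv_pow]
    rw [hN] at this ⊢
    push_cast at this ⊢
    gcongr
  calc Real.exp (-N) ^ 2 * (√2 ^ N / 2 ^ k)
      ≤ Real.exp (-N) ^ 2 * (Real.exp N / 2 ^ k) := by gcongr
    _ = (1 / 2) ^ k * Real.exp (-N) := by
        have : Real.exp (-N) * Real.exp N = 1 := by rw [← Real.exp_add]; simp
        calc _ = (Real.exp (-N) * Real.exp N) * Real.exp (-N) / 2 ^ k := by ring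
          _ = _ := by rw [this, one_div, inv_pow]; ring
    _ ≤ _ := by gcongr

lemma measurable_gridDeviation_integrand (hm : ∀ t, Measurable (B t))
    (hc : ∀ ω, Continuous (B · ω)) (k n : ℕ) :
    Measurable fun p : Ω × ℝ ↦ ENNReal.ofReal (Real.exp (-(2 ^ n : ℕ)) ^ 2) *
      ENNReal.ofReal ((blockMean k (2 ^ n) (gridDiff (k + n) (B · p.1) p.2)
        - √(4 / 3) ^ (2 ^ n)) ^ 2) :=
  (((measurable_blockMean_gridDiff hm hc _ _ _).sub_const _).pow_const 2).ennreal_ofReal.const_mul _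

lemma measurable_gridDeviation (hm : ∀ t, Measurable (B t)) (hc : ∀ ω, Continuous (B · ω))
    (k n : ℕ) : Measurable fun ω ↦ gridDeviation k n (B · ω) :=
  (measurable_gridDeviation_integrand hm hc k n).lintegral_prod_right'

lemma lintegral_gridDeviation_le (hB : IsPreBrownianReal B P) (hm : ∀ t, Measurable (B t))
    (hc : ∀ ω, Continuous (B · ω)) (k n : ℕ) :
    ∫⁻ ω, gridDeviation k n (B · ω) ∂P ≤ ENNReal.ofReal ((1 / 2) ^ k * (1 / 2) ^ n) := by
  have := hB.isGaussianProcess.isProbabilityMeasure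
  unfold gridDeviation
  rw [lintegral_lintegral_swap (measurable_gridDeviation_integrand hm hc k n).aemeasurable]
  calc _ ≤ ∫⁻ _ in Set.Ioc (0 : ℝ) 1, ENNReal.ofReal ((1 / 2) ^ k * (1 / 2) ^ n) := by
        refine setLIntegral_mono' measurableSet_Ioc fun u hu ↦ ?_
        rw [lintegral_const_mul' _ _ ENNReal.ofReal_ne_top]
        refine (mul_le_mul_right
          (lintegral_blockMean_gridDiff_le hB hm (k + n) k (2 ^ n) hu.1.le) _).trans ?_
        rw [← ENNReal.ofReal_mul (by positivity)]
        exact ENNReal.ofReal_le_ofReal (exp_neg_sq_mul_le k n)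
    _ = _ := by
        rw [setLIntegral_const, Real.volume_Ioc]
        norm_num

/-- The expectations are dominated by a double geometric series, so the sum has finite expectation;
its value then bounds every deviation simultaneously. -/
lemma ae_tsum_gridDeviation_lt_top (hB : IsPreBrownianReal B P) (hm : ∀ t, Measurable (B t))
    (hc : ∀ ω, Continuous (B · ω)) :
    ∀ᵐ ω ∂P, ∑' k, ∑' n, gridDeviation k n (B · ω) < ⊤ := by
  have hmeas := measurable_gridDeviation hm hc
  have hmeas' : ∀ k, Measurable fun ω ↦ ∑' n, gridDeviation k n (B · ω) :=
    fun k ↦ Measurable.tsum (hmeas k)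
  refine ae_lt_top (Measurable.tsum hmeas') (ne_top_of_le_ne_top ?_ (b := ∑' k : ℕ, ∑' n : ℕ,
    ENNReal.ofReal ((1 / 2) ^ k * (1 / 2) ^ n)) ?_)
  · have e : ∀ k n : ℕ, ENNReal.ofReal ((1 / 2) ^ k * (1 / 2) ^ n) =
        (1 / 2 : ENNReal) ^ k * (1 / 2) ^ n := by
      intro k n
      rw [ENNReal.ofReal_mul (by positivity), ENNReal.ofReal_pow (by norm_num),
        ENNReal.ofReal_pow (by norm_num), ENNReal.ofReal_div_of_pos (by norm_num)]
      norm_num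
    simp_rw [e, ENNReal.tsum_mul_left, ENNReal.tsum_mul_right, ENNReal.tsum_geometric]
    norm_num
  · rw [lintegral_tsum fun k ↦ (hmeas' k).aemeasurable]
    refine ENNReal.tsum_le_tsum fun k ↦ ?_
    rw [lintegral_tsum fun n ↦ (hmeas k n).aemeasurable]
    exact ENNReal.tsum_le_tsum fun n ↦ lintegral_gridDeviation_le hB hm hc k n

lemma normD_lt_top_of_tsum_lt_top {w : NNReal → ℝ} (hw : Continuous w)
    (h : ∑' k, ∑' n, gridDeviation k n w < ⊤) :
    normD (fun t : ℝ ↦ w t.toNNReal) < ⊤ := by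
  set R := ∑' k, ∑' n, gridDeviation k n w
  have hR : 3 + R ≠ ⊤ := ENNReal.add_ne_top.2 ⟨by norm_num, h.ne⟩
  -- All modulars at scale `√8` are at most `3 + R`, so the norms are at most `√(3 + R) * √8`.
  refine lt_of_le_of_lt ?_ (ENNReal.ofReal_lt_top (r := √(3 + R).toReal * √8))
  refine iSup_le fun j ↦ iSup₂_le fun k hk ↦ ?_
  obtain ⟨n, rfl⟩ := Nat.exists_eq_add_of_le hk
  refine orliczNorm_le_of_modular_le (two_zpow_sub_pos _ _) (two_zpow_sub_le_one hk)
    (by positivity) ?_ ((modular_path_le_gridDeviation hw k n).trans ?_)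
  · rw [← ENNReal.toReal_one]
    refine ENNReal.toReal_mono hR (le_trans ?_ le_self_add)
    norm_num
  · rw [ENNReal.ofReal_toReal hR]
    gcongr
    exact (ENNReal.le_tsum n).trans (ENNReal.le_tsum (f := fun k ↦ ∑' n, gridDeviation k n w) k)

lemma ae_normD_lt_top {W : NNReal → Ω → ℝ} (hW : IsBrownianReal W P) :
    ∀ᵐ ω ∂P, normD (fun t : ℝ ↦ W t.toNNReal ω) < ⊤ := by
  obtain ⟨B, hB, hm, hc, hae⟩ := exists_continuous_measurable_version hW
  filter_upwards [hae, ae_tsum_gridDeviation_lt_top hB hm hc] with ω h1 h2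
  have e : (fun t : ℝ ↦ W t.toNNReal ω) = fun t : ℝ ↦ B t.toNNReal ω := funext fun t ↦ h1 _
  rw [e]
  have h3 := normD_lt_top_of_tsum_lt_top (hc ω) h2
  exact h3

lemma ae_normFrakD_lt_top {W : NNReal → Ω → ℝ} (hW : IsBrownianReal W P) :
    ∀ᵐ ω ∂P, normFrakD (fun t : ℝ ↦ W t.toNNReal ω) < ⊤ := by
  filter_upwards [ae_normD_lt_top hW, hW.cont] with ω h hc
  exact (normFrakD_le (hc.comp continuous_real_toNNReal).continuousOn).trans_lt
    (ENNReal.mul_lt_top ENNReal.ofReal_lt_top h)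

end Brownian

end DyadicAverages

theorem mainTheorem3 :
    -- (i) equivalence, with one absolute constant, for real or complex continuous functions on [0,1]
    (∃ C : ℝ, 0 < C ∧ ∀ (𝕜 : Type) [RCLike 𝕜] (f : ℝ → 𝕜), ContinuousOn f (Set.Icc (0 : ℝ) 1) →
      DyadicAverages.normD f ≤ ENNReal.ofReal C * DyadicAverages.normFrakD f ∧
      DyadicAverages.normFrakD f ≤ ENNReal.ofReal C * DyadicAverages.normD f) ∧
    -- (ii), (iii) finiteness along almost every path of every Wiener process
    (∀ {Ω : Type*} [MeasurableSpace Ω] (P : MeasureTheory.Measure Ω) (W : NNReal → Ω → ℝ),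
      ProbabilityTheory.IsBrownianReal W P →
      (∀ᵐ ω ∂P, DyadicAverages.normD (fun t : ℝ => W t.toNNReal ω) < ⊤) ∧
      (∀ᵐ ω ∂P, DyadicAverages.normFrakD (fun t : ℝ => W t.toNNReal ω) < ⊤)) := by
  refine ⟨⟨6, by norm_num, fun 𝕜 _ f hf ↦
    ⟨DyadicAverages.normD_le hf, DyadicAverages.normFrakD_le hf⟩⟩, fun P W hW ↦
    ⟨DyadicAverages.ae_normD_lt_top hW, DyadicAverages.ae_normFrakD_lt_top hW⟩⟩
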